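/- Let $\Omega\subset\mathbb R^2$ be a bounded polygonal domain (open, connected, equal to the interior of its closure; in particular $\Omega$ may be any bounded polygonal Lipschitz domain), let $\Gamma^D\subset\partial\Omega$ be relatively open, and let $(\mathcal T_h)_h$ be a shape-regular family of conforming finite triangulations exactly fitting $\Omega$ (the closed triangles of each $\mathcal T_h$ cover exactly $\overline\Omega$, and for some $\sigma>0$ independent of $h$ every triangle $T\in\mathcal T_h$ contains a disc of radius at least $h_T/\sigma$, where $h_T=\operatorname{diam}T$). Let $x_T$ be the barycenter of $T$ and $h_{\min}:=\min_{T\in\mathcal T_h}h_T$. Let $V_h:=\prod_{T\in\mathcal T_h}\mathbb P^2(T)^3$ (vector fields $\Omega\to\mathbb R^3$ that are polynomial of total degree at most $2$ on each triangle), let $M_h$ be the space of piecewise constant $\mathbb R^{3\times2}$-valued fields, and let $\Upsilon_h$ be the space of piecewise constant fields with values in the symmetric $2\times2$ matrices. Write $\nabla_h$ and $\nabla_h^2$ for the elementwise gradient and Hessian, $(\cdot,\cdot)$ for the $L^2(\Omega)$ inner product and $A:B$ for the Frobenius product. Let $\mathcal E_h$ consist of the internal edges of $\mathcal T_h$ and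 of the edges which, as open segments, are contained in $\Gamma^D$; $h_e$ is the length of $e$. On an internal edge let $n_e$ be one of its two unit normals and put $[w]=w^--w^+$, $[\nabla_h w]=(\nabla_h w^--\nabla_h w^+)n_e$, where $\pm$ denotes the trace from the side towards which $\pm n_e$ points; on a boundary edge let $n_e$ be the outward unit normal and put $[w]=w$, $[\nabla_h w]=(\nabla_h w)n_e$. Define $$\|w_h\|_{H^2_h(\Omega)}^2:=\|\nabla_h^2w_h\|_{L^2(\Omega)}^2+\sum_{e\in\mathcal E_h}\Big(h_e^{-1}\|[\nabla_hw_h]\|_{L^2(e)}^2+h_e^{-3}\|[w_h]\|_{L^2(e)}^2\Big).$$ Let $\mathbb A_h:=\{y_h\in V_h:\ (\nabla_hy_h(x_T))^{\mathsf T}\nabla_hy_h(x_T)=I_2\ \text{ for all }T\in\mathcal T_h\}$. For $y_h\in\mathbb A_h$ put $$l_h(\nabla_hy_h;\mu,\gamma_h):=\sum_{T\in\mathcal T_h}\int_T\gamma_h:\big(\nabla_hy_h^{\mathsf T}\mu+\mu^{\mathsf T}\nabla_hy_h\big)(x_T)\,dx ,$$ and define the linear operators $L_1:V_h\to\Upsilon_h$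 and $L_2:M_h\to\Upsilon_h$ (which depend on $y_h$) by $$(L_1w_h,\gamma_h)=l_h(\nabla_hy_h;\nabla_hw_h,\gamma_h),\qquad (L_2\mu_h,\gamma_h)=l_h(\nabla_hy_h;\mu_h,\gamma_h)\qquad\text{for all }\gamma_h\in\Upsilon_h .$$ Then there is a constant $\beta'>0$, independent of $h$ and of $y_h$, such that for every $h$ and every $y_h\in\mathbb A_h$ $$\inf_{0\ne\mu_h\in\operatorname{Ker}(L_2)}\ \sup_{0\ne w_h\in\operatorname{Ker}(L_1)}\frac{(\mu_h,\nabla_hw_h)}{\|\mu_h\|_{L^2(\Omega)}\,\|w_h\|_{H^2_h(\Omega)}}\ \ge\ \beta'\,h_{\min}.$$ (If $\|w_h\|_{H^2_h(\Omega)}=0$, which is possible for some $w_h\neq0$ only when the boundary conditions do not make $\|\cdot\|_{H^2_h(\Omega)}$ a norm, the quotient is read as $+\infty$ when its numerator is positive and as $0$ otherwise.) -/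

import Mathlib

open MeasureTheory
open scoped ENNReal Matrix

noncomputable section

namespace PlateFEM

/-- The Euclidean plane. -/
abbrev Plane : Type := EuclideanSpace ℝ (Fin 2)

/-- The Frobenius product `A : B` of two real matrices. -/
def frob {n m : ℕ} (A B : Matrix (Fin n) (Fin m) ℝ) : ℝ := ∑ i, ∑ j, A i j * B i j

/-- The Stiefel manifold `St(n, m)`. -/
def stiefel (n m : ℕ) : Set (Matrix (Fin n) (Fin m) ℝ) := {U | Uᵀ * U = 1}

/-- A (conforming, finite) triangulation exactly fitting `Ω`: a finite geometric simplicial complex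
in the plane, all of whose faces are faces of triangles, and whose underlying space is the
closure of `Ω`. -/
structure Triangulation (Ω : Set Plane) where
  complex : Geometry.SimplicialComplex ℝ Plane
  finite_faces : complex.faces.Finite
  pure : ∀ s ∈ complex.faces, ∃ t ∈ complex.faces, s ⊆ t ∧ t.card = 3
  space_eq : complex.space = closure Ω

namespace Triangulation

variable {Ω : Set Plane} (𝒯 : Triangulation Ω)

/-- The triangles of the mesh, each given by its set of three vertices. -/
def Cell : Type := {T : Finset Plane // T ∈ 𝒯.complex.faces ∧ T.card = 3}

/-- The edges of the mesh, each given by its set of two endpoints. -/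
def Edge : Type := {e : Finset Plane // e ∈ 𝒯.complex.faces ∧ e.card = 2}

instance : Finite 𝒯.Cell := (𝒯.finite_faces.subset (fun _ h => h.1) :
  {T : Finset Plane | T ∈ 𝒯.complex.faces ∧ T.card = 3}.Finite).to_subtype

instance : Finite 𝒯.Edge := (𝒯.finite_faces.subset (fun _ h => h.1) :
  {e : Finset Plane | e ∈ 𝒯.complex.faces ∧ e.card = 2}.Finite).to_subtype

instance : Fintype 𝒯.Cell := Fintype.ofFinite _

instance : Fintype 𝒯.Edge := Fintype.ofFinite _

variable {𝒯}

/-- The closed triangle. -/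
def Cell.carrier (T : 𝒯.Cell) : Set Plane := convexHull ℝ (T.1 : Set Plane)

/-- The closed edge. -/
def Edge.carrier (e : 𝒯.Edge) : Set Plane := convexHull ℝ (e.1 : Set Plane)

/-- The diameter `h_T` of a triangle. -/
def Cell.diam (T : 𝒯.Cell) : ℝ := Metric.diam T.carrier

/-- The length `h_e` of an edge. -/
def Edge.diam (e : 𝒯.Edge) : ℝ := Metric.diam e.carrier

/-- The barycenter `x_T` of a triangle. -/
def Cell.barycenter (T : 𝒯.Cell) : Plane := (3 : ℝ)⁻¹ • ∑ v ∈ T.1, v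

variable (𝒯)

/-- `h_min`, the smallest diameter of a triangle of the mesh. -/
def hMin : ℝ := ⨅ T : 𝒯.Cell, T.diam

/-- Shape regularity with constant `σ`: every triangle contains a disc of radius `r ≥ h_T / σ`. -/
def IsShapeRegular (σ : ℝ) : Prop :=
  ∀ T : 𝒯.Cell, ∃ (c : Plane) (r : ℝ), Metric.closedBall c r ⊆ T.carrier ∧ T.diam ≤ σ * r

variable {𝒯}

/-- An internal edge is shared by two different triangles. -/
def Edge.IsInternal (e : 𝒯.Edge) : Prop := ∃ T T' : 𝒯.Cell, T ≠ T' ∧ e.1 ⊆ T.1 ∧ e.1 ⊆ T'.1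

/-- The active edges: the internal ones and those (as open segments) contained in `ΓD`. -/
def Edge.IsActive (ΓD : Set Plane) (e : 𝒯.Edge) : Prop :=
  e.IsInternal ∨ intrinsicInterior ℝ e.carrier ⊆ ΓD

variable (𝒯)

open Classical in
/-- The set of active edges, whose union is the skeleton. -/
def activeEdges (ΓD : Set Plane) : Finset 𝒯.Edge := Finset.univ.filter (Edge.IsActive ΓD)

variable {𝒯}

/-- For each edge there is a unit normal that, if the edge belongs to a single triangle, points out
of this triangle. -/
theorem Edge.exists_normal (e : 𝒯.Edge) : ∃ n : Plane, ‖n‖ = 1 ∧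
    (∀ a ∈ e.1, ∀ b ∈ e.1, inner ℝ n (b - a) = 0) ∧
    (¬ e.IsInternal → ∀ T : 𝒯.Cell, e.1 ⊆ T.1 → ∀ c ∈ T.1, ∀ a ∈ e.1, inner ℝ n (c - a) ≤ 0) := by
  classical
  obtain ⟨p, q, hpq, he⟩ := Finset.card_eq_two.1 e.2.2
  obtain ⟨n, hn, hno⟩ : ∃ n : Plane, ‖n‖ = 1 ∧ inner ℝ n (q - p) = 0 := by
    set d := q - p with hd
    have hd0 : d ≠ 0 := sub_ne_zero.2 (Ne.symm hpq)
    set m : Plane := !₂[- d 1, d 0] with hm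
    have hm0 : m ≠ 0 := by
      intro h
      apply hd0
      have h0 := congrArg (fun x : Plane => x 0) h
      have h1 := congrArg (fun x : Plane => x 1) h
      simp [hm] at h0 h1
      ext i
      fin_cases i <;> simp [h0, h1]
    refine ⟨‖m‖⁻¹ • m, ?_, ?_⟩
    · rw [norm_smul, norm_inv, norm_norm, inv_mul_cancel₀ (norm_ne_zero_iff.2 hm0)]
    · rw [inner_smul_left]
      have : inner ℝ m d = 0 := by
        simp [hm, PiLp.inner_apply, Fin.sum_univ_two]
        ring
      rw [this, mul_zero]
  have key : ∀ n : Plane, inner ℝ n (q - p) = 0 →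
      ∀ a ∈ e.1, ∀ b ∈ e.1, inner ℝ n (b - a) = 0 := by
    intro n hno a ha b hb
    rw [inner_sub_right] at hno ⊢
    rw [he] at ha hb
    simp only [Finset.mem_insert, Finset.mem_singleton] at ha hb
    rcases ha with rfl | rfl <;> rcases hb with rfl | rfl <;> linarith
  by_cases hint : e.IsInternal
  · exact ⟨n, hn, key n hno, fun h => absurd hint h⟩
  by_cases hT : ∃ T : 𝒯.Cell, e.1 ⊆ T.1
  swap
  · exact ⟨n, hn, key n hno, fun _ T h => absurd ⟨T, h⟩ hT⟩
  obtain ⟨T, heT⟩ := hT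
  have huniq : ∀ T' : 𝒯.Cell, e.1 ⊆ T'.1 → T' = T := by
    intro T' h'
    by_contra hne
    exact hint ⟨T', T, hne, h', heT⟩
  obtain ⟨c, hc⟩ : ∃ c, T.1 \ e.1 = {c} := by
    rw [← Finset.card_eq_one, Finset.card_sdiff_of_subset heT, T.2.2, e.2.2]
  have hsign : ∀ n : Plane, inner ℝ n (q - p) = 0 → inner ℝ n (c - p) ≤ 0 →
      ∀ T : 𝒯.Cell, e.1 ⊆ T.1 → ∀ c ∈ T.1, ∀ a ∈ e.1, inner ℝ n (c - a) ≤ 0 := by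
    intro n hno hcp T' hT' c' hc' a ha
    obtain rfl := huniq T' hT'
    by_cases hce : c' ∈ e.1
    · exact (key n hno a ha c' hce).le
    · have : c' = c := by
        rw [← Finset.mem_singleton, ← hc]
        exact Finset.mem_sdiff.2 ⟨hc', hce⟩
      subst this
      have h2 := key n hno p (by simp [he]) a ha
      rw [inner_sub_right] at h2 hcp ⊢
      linarith
  rcases le_total (inner ℝ n (c - p)) 0 with h | h
  · exact ⟨n, hn, key n hno, fun _ => hsign n hno h⟩
  · have hno' : inner ℝ (-n) (q - p) = 0 := by rw [inner_neg_left, hno, neg_zero]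
    exact ⟨-n, by rwa [norm_neg], key _ hno',
      fun _ => hsign _ hno' (by rw [inner_neg_left]; linarith)⟩

/-- The unit normal `n_e`: one of the two normals to an internal edge, and the outward one on a
boundary edge. -/
def Edge.normal (e : 𝒯.Edge) : Plane := e.exists_normal.choose

open Classical in
/-- For a triangle `T` having `e` as an edge: `-1` if `T` lies on the side of `e` into which `n_e`
points (the side of the trace `+`), and `1` otherwise (the side of the trace `-`). -/
def Edge.side (e : 𝒯.Edge) (T : 𝒯.Cell) : ℝ :=
  if ∃ c ∈ T.1, ∃ a ∈ e.1, 0 < inner ℝ e.normal (c - a) then -1 else 1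

variable (𝒯)

/-- The space `V_h` of vector fields with values in `ℝ³` that are polynomial of total degree at most
two on every triangle: the product over the triangles of the polynomial spaces. -/
abbrev Vh : Type := 𝒯.Cell → Fin 3 → MvPolynomial.restrictTotalDegree (Fin 2) ℝ 2

/-- The space `M_h` of piecewise constant `3 × 2` matrix fields. -/
abbrev Mh : Type := 𝒯.Cell → Matrix (Fin 3) (Fin 2) ℝ

/-- The space `Υ_h` of piecewise constant symmetric `2 × 2` matrix fields. -/
def Upsh : Submodule ℝ (𝒯.Cell → Matrix (Fin 2) (Fin 2) ℝ) where
  carrier := {γ | ∀ T, (γ T)ᵀ = γ T}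
  add_mem' := by
    intro a b ha hb T
    simp [Matrix.transpose_add, ha T, hb T]
  zero_mem' := by intro T; simp
  smul_mem' := by
    intro c a ha T
    simp [Matrix.transpose_smul, ha T]

variable {𝒯}

/-- The value of `w` at `x`, computed from the triangle `T`. -/
def val (w : 𝒯.Vh) (T : 𝒯.Cell) (x : Plane) (i : Fin 3) : ℝ :=
  MvPolynomial.eval (fun l => x l) (w T i).1

/-- The broken gradient: `(∇_h w)_{ij} = ∂_j w_i` on the triangle `T`. -/
def grad (w : 𝒯.Vh) (T : 𝒯.Cell) (x : Plane) : Matrix (Fin 3) (Fin 2) ℝ :=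
  Matrix.of fun i j => MvPolynomial.eval (fun l => x l) (MvPolynomial.pderiv j (w T i).1)

/-- The broken Hessian: `(∇²_h w)_{ijk} = ∂_k ∂_j w_i` on the triangle `T`. -/
def hess (w : 𝒯.Vh) (T : 𝒯.Cell) (x : Plane) (i : Fin 3) (j k : Fin 2) : ℝ :=
  MvPolynomial.eval (fun l => x l)
    (MvPolynomial.pderiv k (MvPolynomial.pderiv j (w T i).1))

open Classical in
/-- The jump of `w` over `e`: `w⁻ - w⁺` on an internal edge, `w` on a boundary edge. -/
def jump (w : 𝒯.Vh) (e : 𝒯.Edge) (x : Plane) (i : Fin 3) : ℝ :=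
  ∑ T : 𝒯.Cell with e.1 ⊆ T.1, e.side T * val w T x i

open Classical in
/-- The jump of the normal derivative over `e`: `(∇_h w⁻ - ∇_h w⁺) n_e` on an internal edge,
`(∇_h w) n_e` on a boundary edge. -/
def jumpGrad (w : 𝒯.Vh) (e : 𝒯.Edge) (x : Plane) (i : Fin 3) : ℝ :=
  ∑ T : 𝒯.Cell with e.1 ⊆ T.1, e.side T * ∑ j, grad w T x i j * e.normal j

/-- The discrete norm `‖w‖_{H²_h(Ω)}`; the integrals over the edges are with respect to the length
(one-dimensional Hausdorff) measure. -/
def normH2h (ΓD : Set Plane) (w : 𝒯.Vh) : ℝ :=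
  Real.sqrt ((∑ T : 𝒯.Cell, ∫ x in T.carrier, ∑ i, ∑ j, ∑ k, hess w T x i j k ^ 2)
    + (∑ e ∈ 𝒯.activeEdges ΓD,
        e.diam⁻¹ * ∫ x in e.carrier, ∑ i, jumpGrad w e x i ^ 2 ∂(Measure.hausdorffMeasure 1))
    + (∑ e ∈ 𝒯.activeEdges ΓD,
        (e.diam ^ 3)⁻¹ * ∫ x in e.carrier, ∑ i, jump w e x i ^ 2 ∂(Measure.hausdorffMeasure 1)))

/-- The `L²(Ω)` inner product of two broken matrix fields. -/
def innerL2 {n m : ℕ} (μ ν : 𝒯.Cell → Plane → Matrix (Fin n) (Fin m) ℝ) : ℝ :=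
  ∑ T : 𝒯.Cell, ∫ x in T.carrier, frob (μ T x) (ν T x)

/-- A piecewise constant matrix field, as a broken matrix field. -/
def const {n m : ℕ} (μ : 𝒯.Cell → Matrix (Fin n) (Fin m) ℝ) :
    𝒯.Cell → Plane → Matrix (Fin n) (Fin m) ℝ := fun T _ => μ T

/-- The `L²(Ω)` norm of a broken matrix field. -/
def normL2 {n m : ℕ} (μ : 𝒯.Cell → Plane → Matrix (Fin n) (Fin m) ℝ) : ℝ :=
  Real.sqrt (innerL2 μ μ)

variable (𝒯)

/-- The discrete admissible set `𝔸_h`. -/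
def admissible : Set 𝒯.Vh := {y | ∀ T : 𝒯.Cell, grad y T T.barycenter ∈ stiefel 3 2}

variable {𝒯}

/-- The trilinear form `l_h(∇_h y; μ, γ)`. -/
def lh (y : 𝒯.Vh) (μ : 𝒯.Cell → Plane → Matrix (Fin 3) (Fin 2) ℝ)
    (γ : 𝒯.Cell → Matrix (Fin 2) (Fin 2) ℝ) : ℝ :=
  ∑ T : 𝒯.Cell, ∫ _x in T.carrier,
    frob (γ T) ((grad y T T.barycenter)ᵀ * μ T T.barycenter
      + (μ T T.barycenter)ᵀ * grad y T T.barycenter)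

theorem Cell.volume_real_pos (T : 𝒯.Cell) : 0 < volume.real T.carrier := by
  have hai : AffineIndependent ℝ ((↑) : T.1 → Plane) := 𝒯.complex.indep T.2.1
  have hspan : affineSpan ℝ (T.1 : Set Plane) = ⊤ := by
    have h := (hai.affineSpan_eq_top_iff_card_eq_finrank_add_one).2 (by
      rw [Fintype.card_coe, T.2.2, finrank_euclideanSpace_fin])
    simpa using h
  have hint : (interior T.carrier).Nonempty := interior_convexHull_nonempty_iff_affineSpan_eq_top.2 hspan
  have hcomp : IsCompact T.carrier := T.1.finite_toSet.isCompact_convexHull ℝ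
  exact ENNReal.toReal_pos (Measure.measure_pos_of_nonempty_interior _ hint).ne'
    hcomp.measure_lt_top.ne

theorem frob_comm {n m : ℕ} (A B : Matrix (Fin n) (Fin m) ℝ) : frob A B = frob B A := by
  simp only [frob, mul_comm]

/-- Two piecewise constant symmetric fields with the same `L²` products with `Υ_h` are equal. -/
theorem upsh_ext {a b : 𝒯.Upsh}
    (h : ∀ γ : 𝒯.Upsh, innerL2 (const a.1) (const γ.1) = innerL2 (const b.1) (const γ.1)) :
    a = b := by
  have h0 := h (a - b)
  have h1 : ∑ T : 𝒯.Cell, volume.real T.carrier * ∑ i, ∑ j, (a.1 T i j - b.1 T i j) ^ 2 = 0 := by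
    rw [← sub_eq_zero] at h0
    rw [← h0]
    simp only [innerL2, const, setIntegral_const, smul_eq_mul, ← Finset.sum_sub_distrib, ← mul_sub,
      frob]
    refine Finset.sum_congr rfl fun T _ => ?_
    congr 1
    refine Finset.sum_congr rfl fun i _ => Finset.sum_congr rfl fun j _ => ?_
    simp
    ring
  have hnn : ∀ T : 𝒯.Cell, 0 ≤ ∑ i, ∑ j, (a.1 T i j - b.1 T i j) ^ 2 := fun T =>
    Finset.sum_nonneg fun i _ => Finset.sum_nonneg fun j _ => sq_nonneg _
  rw [Finset.sum_eq_zero_iff_of_nonneg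
    (fun T _ => mul_nonneg T.volume_real_pos.le (hnn T))] at h1
  ext T i j
  have h2 := (mul_eq_zero.1 (h1 T (Finset.mem_univ T))).resolve_left T.volume_real_pos.ne'
  rw [Finset.sum_eq_zero_iff_of_nonneg
    (fun i _ => Finset.sum_nonneg fun j _ => sq_nonneg _)] at h2
  have h3 := h2 i (Finset.mem_univ i)
  rw [Finset.sum_eq_zero_iff_of_nonneg (fun j _ => sq_nonneg _)] at h3
  exact sub_eq_zero.1 (pow_eq_zero_iff (two_ne_zero)|>.1 (h3 j (Finset.mem_univ j)))

/-- The variational equation that defines `L₁` has exactly one solution. -/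
theorem existsUnique_L1 (y : 𝒯.Vh) : ∃! L : 𝒯.Vh →ₗ[ℝ] 𝒯.Upsh, ∀ (w : 𝒯.Vh) (γ : 𝒯.Upsh),
    innerL2 (const (L w).1) (const γ.1) = lh y (grad w) γ.1 := by
  refine ⟨⟨⟨fun w => ⟨fun T => (grad y T T.barycenter)ᵀ * grad w T T.barycenter
      + (grad w T T.barycenter)ᵀ * grad y T T.barycenter, ?_⟩, ?_⟩, ?_⟩, ?_, ?_⟩
  · intro T
    simp [Matrix.transpose_add, Matrix.transpose_mul, add_comm]
  · intro w w'
    ext T i j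
    have : grad (w + w') T T.barycenter = grad w T T.barycenter + grad w' T T.barycenter := by
      ext i j; simp [grad]
    simp [this, Matrix.mul_add, Matrix.add_mul]
    ring
  · intro c w
    ext T i j
    have : grad (c • w) T T.barycenter = c • grad w T T.barycenter := by
      ext i j; simp [grad, MvPolynomial.smul_eval]
    simp [this]
    ring
  · intro w γ
    simp only [innerL2, lh, const, LinearMap.coe_mk, AddHom.coe_mk]
    refine Finset.sum_congr rfl fun T _ => ?_
    rw [frob_comm]
  · intro L hL
    ext1 w
    refine upsh_ext fun γ => ?_
    rw [hL]
    simp only [innerL2, lh, const, LinearMap.coe_mk, AddHom.coe_mk]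
    refine Finset.sum_congr rfl fun T _ => ?_
    rw [frob_comm]

/-- The variational equation that defines `L₂` has exactly one solution. -/
theorem existsUnique_L2 (y : 𝒯.Vh) : ∃! L : 𝒯.Mh →ₗ[ℝ] 𝒯.Upsh, ∀ (μ : 𝒯.Mh) (ζ : 𝒯.Upsh),
    innerL2 (const (L μ).1) (const ζ.1) = lh y (const μ) ζ.1 := by
  refine ⟨⟨⟨fun μ => ⟨fun T => (grad y T T.barycenter)ᵀ * μ T
      + (μ T)ᵀ * grad y T T.barycenter, ?_⟩, ?_⟩, ?_⟩, ?_, ?_⟩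
  · intro T
    simp [Matrix.transpose_add, Matrix.transpose_mul, add_comm]
  · intro μ μ'
    ext T i j
    simp [Matrix.mul_add, Matrix.add_mul]
    ring
  · intro c μ
    ext T i j
    simp
    ring
  · intro w γ
    simp only [innerL2, lh, const, LinearMap.coe_mk, AddHom.coe_mk]
    refine Finset.sum_congr rfl fun T _ => ?_
    rw [frob_comm]
  · intro L hL
    ext1 w
    refine upsh_ext fun γ => ?_
    rw [hL]
    simp only [innerL2, lh, const, LinearMap.coe_mk, AddHom.coe_mk]
    refine Finset.sum_congr rfl fun T _ => ?_
    rw [frob_comm]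

/-- The operator `L₁ : V_h → Υ_h`, defined by `(L₁ w, γ) = l_h(∇_h y; ∇_h w, γ)` for all `γ`. -/
def L1 (y : 𝒯.Vh) : 𝒯.Vh →ₗ[ℝ] 𝒯.Upsh := (existsUnique_L1 y).choose

/-- The operator `L₂ : M_h → Υ_h`, defined by `(L₂ μ, ζ) = l_h(∇_h y; μ, ζ)` for all `ζ`. -/
def L2 (y : 𝒯.Vh) : 𝒯.Mh →ₗ[ℝ] 𝒯.Upsh := (existsUnique_L2 y).choose

theorem L1_spec (y w : 𝒯.Vh) (γ : 𝒯.Upsh) :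
    innerL2 (const (L1 y w).1) (const γ.1) = lh y (grad w) γ.1 :=
  (existsUnique_L1 y).choose_spec.1 w γ

theorem L2_spec (y : 𝒯.Vh) (μ : 𝒯.Mh) (ζ : 𝒯.Upsh) :
    innerL2 (const (L2 y μ).1) (const ζ.1) = lh y (const μ) ζ.1 :=
  (existsUnique_L2 y).choose_spec.1 μ ζ

/-- The quotient of the inf-sup condition. It is taken in `[0, ∞]`, with `a / 0 = ∞` for `a > 0`;
negative values, which never matter for the supremum over a linear space, are replaced by `0`. -/
def infSupQuotient (ΓD : Set Plane) (μ : 𝒯.Mh) (w : 𝒯.Vh) : ℝ≥0∞ :=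
  ENNReal.ofReal (innerL2 (const μ) (grad w)) /
    ENNReal.ofReal (normL2 (const μ) * normH2h ΓD w)

end Triangulation

end PlateFEM

end

/-!
Given `μ ∈ Ker L₂`, test with the field `w` that on each triangle `T` is the affine map
`x ↦ μ_T (x - x_T)` (`affineField`). Its broken gradient is `μ`, and the operators `L₁` and `L₂` see a
field only through this gradient, so `w ∈ Ker L₁` (`L1_affineField`) and `(μ, ∇_h w) = ‖μ‖²`. It
remains to prove the inverse estimate `β' h_min ‖w‖_{H²_h} ≤ ‖μ‖` (`infSupConst_mul_normH2h_le`).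

The broken Hessian of `w` is zero. On an edge `e` of `T` the gradient of `w` is `μ_T` and
`|w| ≤ h_T |μ_T|`, since `w` vanishes at the barycenter. Shape regularity gives `h_T ≤ (σ / 2) h_e`
(`IsShapeRegular.cell_diam_le`), because a triangle lies in a strip of width at most `h_e`, and it
bounds the number of triangles at an edge by `σ⁴ / 4` (`IsShapeRegular.card_cells_le`), because
triangles of the mesh do not overlap. Hence both weighted jump terms on `e` are bounded by a constant
times the sum of `|μ_T|²` over the triangles `T` at `e`, and `‖w‖²_{H²_h} ≤ C ∑_T |μ_T|²`
(`normH2h_affineField_sq_le`). On the other hand a triangle has area at least of order `h_min²`, so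
`‖μ‖² ≥ c h_min² ∑_T |μ_T|²` (`discArea_mul_hMin_sq_le_innerL2`).
-/

noncomputable section

namespace PlateFEM

/-! ### Plane geometry -/

theorem exists_unit_inner_eq_zero (d : Plane) : ∃ n : Plane, ‖n‖ = 1 ∧ inner ℝ n d = 0 := by
  obtain ⟨m, hm, hm0⟩ : ∃ m : Plane, inner ℝ m d = 0 ∧ m ≠ 0 := by
    by_cases hd : d = 0
    · obtain ⟨m, hm⟩ := exists_ne (0 : Plane)
      exact ⟨m, by simp [hd], hm⟩
    · refine ⟨!₂[-d 1, d 0], ?_, fun h => hd ?_⟩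
      · simp [PiLp.inner_apply, Fin.sum_univ_two]
        ring
      · have h0 := congrArg (fun x : Plane => x 0) h
        have h1 := congrArg (fun x : Plane => x 1) h
        simp at h0 h1
        ext i
        fin_cases i <;> simp [h0, h1]
  refine ⟨‖m‖⁻¹ • m, ?_, ?_⟩
  · rw [norm_smul, norm_inv, norm_norm, inv_mul_cancel₀ (norm_ne_zero_iff.2 hm0)]
  · rw [inner_smul_left, hm, mul_zero]

/-- A triangle lies in the strip through the endpoints of one side that is parallel to another side,
so the length of a side bounds the diameter of an inscribed disc. -/
theorem two_mul_radius_le_dist {a b c z : Plane} {r : ℝ} (hr : 0 ≤ r)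
    (h : Metric.closedBall z r ⊆ convexHull ℝ {a, b, c}) : 2 * r ≤ dist a b := by
  obtain ⟨n, hn, hnc⟩ := exists_unit_inner_eq_zero (c - a)
  have hstrip : convexHull ℝ {a, b, c} ⊆
      innerSL ℝ n ⁻¹' Set.uIcc (inner ℝ n a) (inner ℝ n b) := by
    refine convexHull_min ?_ ((convex_uIcc _ _).linear_preimage (innerSL ℝ n).toLinearMap)
    rw [inner_sub_right, sub_eq_zero] at hnc
    rintro x (rfl | rfl | rfl)
    · simp
    · simp
    · simp [hnc]
  -- the disc contains `z ± r • n`, whose values under `inner ℝ n` differ by `2 * r`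
  have hball : ∀ s : ℝ, |s| = r → inner ℝ n z + s ∈ Set.uIcc (inner ℝ n a) (inner ℝ n b) := by
    intro s hs
    have h1 : z + s • n ∈ Metric.closedBall z r := by
      simp [norm_smul, hn, hs]
    have h2 := hstrip (h h1)
    simpa [inner_add_right, inner_smul_right, hn] using h2
  have h1 := Real.dist_le_of_mem_uIcc (hball r (abs_of_nonneg hr))
    (hball (-r) (by rw [abs_neg, abs_of_nonneg hr]))
  rw [Real.dist_eq, Real.dist_eq, ← inner_sub_right] at h1
  have h2 : |inner ℝ n (a - b)| ≤ dist a b := by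
    simpa [hn, dist_eq_norm] using abs_real_inner_le_norm n (a - b)
  have h3 : |inner ℝ n z + r - (inner ℝ n z + -r)| = 2 * r := by
    rw [show inner ℝ n z + r - (inner ℝ n z + -r) = 2 * r by ring, abs_of_nonneg (by linarith)]
  linarith

/-- The area of the unit disc. -/
def discArea : ℝ := volume.real (Metric.ball (0 : Plane) 1)

theorem discArea_pos : 0 < discArea :=
  ENNReal.toReal_pos (Metric.measure_ball_pos _ _ one_pos).ne' measure_ball_lt_top.ne

theorem volume_real_closedBall (x : Plane) {r : ℝ} (hr : 0 ≤ r) :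
    volume.real (Metric.closedBall x r) = discArea * r ^ 2 := by
  rw [Measure.addHaar_real_closedBall _ _ hr, finrank_euclideanSpace_fin, mul_comm, discArea]

namespace Triangulation

variable {Ω : Set Plane} {𝒯 : Triangulation Ω}

/-! ### Shape-regular meshes -/

theorem Cell.isCompact_carrier (T : 𝒯.Cell) : IsCompact T.carrier :=
  T.1.finite_toSet.isCompact_convexHull ℝ

theorem Cell.dist_le_diam (T : 𝒯.Cell) {x y : Plane} (hx : x ∈ T.carrier) (hy : y ∈ T.carrier) :
    dist x y ≤ T.diam :=
  Metric.dist_le_diam_of_mem T.isCompact_carrier.isBounded hx hy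

theorem Cell.barycenter_mem (T : 𝒯.Cell) : T.barycenter ∈ T.carrier := by
  rw [Cell.barycenter, Finset.smul_sum]
  refine (convex_convexHull ℝ _).sum_mem (fun _ _ => by norm_num) ?_
    fun v hv => subset_convexHull ℝ _ hv
  simp [T.2.2]

theorem Edge.carrier_subset {e : 𝒯.Edge} {T : 𝒯.Cell} (h : e.1 ⊆ T.1) : e.carrier ⊆ T.carrier :=
  convexHull_mono (Finset.coe_subset.2 h)

theorem Edge.exists_carrier_eq_segment (e : 𝒯.Edge) : ∃ a b : Plane, a ≠ b ∧ e.1 = {a, b} ∧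
    e.carrier = segment ℝ a b ∧ e.diam = dist a b := by
  classical
  obtain ⟨a, b, hab, he⟩ := Finset.card_eq_two.1 e.2.2
  refine ⟨a, b, hab, he, ?_, ?_⟩
  · simp [Edge.carrier, he, convexHull_pair]
  · rw [Edge.diam, Edge.carrier, convexHull_diam, he]
    simp [Metric.diam_pair]

theorem Edge.diam_pos (e : 𝒯.Edge) : 0 < e.diam := by
  obtain ⟨a, b, hab, -, -, hd⟩ := e.exists_carrier_eq_segment
  rw [hd]
  exact dist_pos.2 hab

theorem Edge.hausdorffMeasure_carrier (e : 𝒯.Edge) :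
    Measure.hausdorffMeasure 1 e.carrier = ENNReal.ofReal e.diam := by
  obtain ⟨a, b, -, -, hc, hd⟩ := e.exists_carrier_eq_segment
  rw [hc, hd, hausdorffMeasure_segment, edist_dist]

theorem Edge.diam_le_cell_diam {e : 𝒯.Edge} {T : 𝒯.Cell} (h : e.1 ⊆ T.1) : e.diam ≤ T.diam :=
  Metric.diam_mono (Edge.carrier_subset h) T.isCompact_carrier.isBounded

theorem Edge.card_cell_edges_le (T : 𝒯.Cell) [DecidablePred fun e : 𝒯.Edge => e.1 ⊆ T.1] :
    (Finset.univ.filter fun e : 𝒯.Edge => e.1 ⊆ T.1).card ≤ 3 := by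
  classical
  have h3 : (T.1.powersetCard 2).card = 3 := by
    rw [Finset.card_powersetCard, T.2.2]
    rfl
  refine le_trans ?_ h3.le
  refine Finset.card_le_card_of_injOn Subtype.val (fun e he => ?_) Subtype.val_injective.injOn
  exact Finset.mem_powersetCard.2 ⟨by simpa using he, e.2.2⟩

theorem Cell.diam_nonneg (T : 𝒯.Cell) : 0 ≤ T.diam := Metric.diam_nonneg

theorem Cell.hMin_le_diam (T : 𝒯.Cell) : 𝒯.hMin ≤ T.diam :=
  ciInf_le (Set.finite_range _).bddBelow T

variable (𝒯) in
theorem hMin_nonneg : 0 ≤ 𝒯.hMin := Real.iInf_nonneg fun T => T.diam_nonneg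

namespace IsShapeRegular

variable {σ : ℝ}

theorem discArea_mul_sq_le (h𝒯 : 𝒯.IsShapeRegular σ) (hσ : 0 < σ) (T : 𝒯.Cell) :
    discArea * (T.diam / σ) ^ 2 ≤ volume.real T.carrier := by
  obtain ⟨c, r, hcr, hr⟩ := h𝒯 T
  have hr' : T.diam / σ ≤ r := (div_le_iff₀' hσ).2 hr
  have h0 : 0 ≤ T.diam / σ := div_nonneg T.diam_nonneg hσ.le
  calc discArea * (T.diam / σ) ^ 2 ≤ discArea * r ^ 2 := by
        have := discArea_pos
        gcongr
    _ = volume.real (Metric.closedBall c r) := (volume_real_closedBall c (h0.trans hr')).symm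
    _ ≤ volume.real T.carrier := measureReal_mono hcr T.isCompact_carrier.measure_lt_top.ne

/-- In a shape-regular mesh the diameter of a triangle is bounded by the length of its sides. -/
theorem cell_diam_le (h𝒯 : 𝒯.IsShapeRegular σ) (hσ : 0 < σ) {e : 𝒯.Edge} {T : 𝒯.Cell}
    (he : e.1 ⊆ T.1) : T.diam ≤ σ / 2 * e.diam := by
  classical
  obtain ⟨z, r, hzr, hr⟩ := h𝒯 T
  obtain ⟨a, b, hab, hab', -, hd⟩ := e.exists_carrier_eq_segment
  obtain ⟨c, hc⟩ : ∃ c, T.1 \ e.1 = {c} := by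
    rw [← Finset.card_eq_one, Finset.card_sdiff_of_subset he, T.2.2, e.2.2]
  have hT : (T.1 : Set Plane) = {a, b, c} := by
    have h1 := Finset.union_sdiff_of_subset he
    rw [hc, hab'] at h1
    rw [← h1]
    ext x
    simp
  have hr0 : 0 ≤ r :=
    ((div_nonneg T.diam_nonneg hσ.le).trans ((div_le_iff₀' hσ).2 hr))
  rw [Cell.carrier, hT] at hzr
  have h2 := two_mul_radius_le_dist hr0 hzr
  rw [hd]
  nlinarith

end IsShapeRegular

/-- Two triangles of the mesh meet in the convex hull of at most two points. -/
theorem Cell.aedisjoint {T T' : 𝒯.Cell} (h : T ≠ T') :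
    AEDisjoint volume T.carrier T'.carrier := by
  classical
  have hcard : (T.1 ∩ T'.1).card < 3 := by
    by_contra! h3
    have h1 : T.1 ∩ T'.1 = T.1 :=
      Finset.eq_of_subset_of_card_le Finset.inter_subset_left (by rw [T.2.2]; exact h3)
    have h2 : T.1 ∩ T'.1 = T'.1 :=
      Finset.eq_of_subset_of_card_le Finset.inter_subset_right (by rw [T'.2.2]; exact h3)
    exact h (Subtype.ext (h1.symm.trans h2))
  have hne : affineSpan ℝ ((T.1 ∩ T'.1 : Finset Plane) : Set Plane) ≠ ⊤ := by
    intro htop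
    have hnonempty : (T.1 ∩ T'.1).Nonempty := by
      rw [Finset.nonempty_iff_ne_empty]
      intro h0
      rw [h0, Finset.coe_empty, AffineSubspace.span_empty] at htop
      exact bot_ne_top htop
    have : Nonempty ↥(T.1 ∩ T'.1) := hnonempty.to_subtype
    have h1 := finrank_vectorSpan_range_add_one_le ℝ ((↑) : ↥(T.1 ∩ T'.1) → Plane)
    rw [Subtype.range_coe_subtype, Finset.setOfPred_mem, ← direction_affineSpan, htop,
      AffineSubspace.direction_top, finrank_top, finrank_euclideanSpace_fin,
      Fintype.card_coe] at h1
    omega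
  refine measure_mono_null ?_ (Measure.addHaar_affineSubspace volume _ hne)
  refine (𝒯.complex.inter_subset_convexHull T.2.1 T'.2.1).trans ?_
  rw [Finset.coe_inter]
  exact convexHull_subset_affineSpan _

open Classical in
/-- The number of triangles sharing an edge is bounded, by comparing areas: these triangles do not
overlap, each has area of order `h_e²`, and all lie in a disc of radius of order `h_e`. -/
theorem IsShapeRegular.card_cells_le {σ : ℝ} (h𝒯 : 𝒯.IsShapeRegular σ) (hσ : 0 < σ)
    (e : 𝒯.Edge) :
    ((Finset.univ.filter fun T : 𝒯.Cell => e.1 ⊆ T.1).card : ℝ) ≤ σ ^ 4 / 4 := by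
  set S := Finset.univ.filter fun T : 𝒯.Cell => e.1 ⊆ T.1 with hS
  have hmem : ∀ T ∈ S, e.1 ⊆ T.1 := fun T hT => (Finset.mem_filter.1 hT).2
  have he := e.diam_pos
  have hd := discArea_pos
  obtain ⟨a, b, -, hab, -, -⟩ := e.exists_carrier_eq_segment
  have hsub : (⋃ T ∈ S, T.carrier) ⊆ Metric.closedBall a (σ / 2 * e.diam) := by
    refine Set.iUnion₂_subset fun T hT x hx => ?_
    refine (T.dist_le_diam hx ?_).trans (h𝒯.cell_diam_le hσ (hmem T hT))
    exact subset_convexHull ℝ _ (hmem T hT (hab ▸ Finset.mem_insert_self a {b}))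
  have hvol : volume.real (⋃ T ∈ S, T.carrier) = ∑ T ∈ S, volume.real T.carrier :=
    measureReal_biUnion_finset₀ (fun T _ T' _ h => Cell.aedisjoint h)
      (fun T _ => T.isCompact_carrier.measurableSet.nullMeasurableSet)
      (fun T _ => T.isCompact_carrier.measure_lt_top.ne)
  have hlow : (S.card : ℝ) * (discArea * (e.diam / σ) ^ 2) ≤ ∑ T ∈ S, volume.real T.carrier := by
    rw [← nsmul_eq_mul]
    refine Finset.card_nsmul_le_sum _ _ _ fun T hT => ?_
    refine le_trans ?_ (h𝒯.discArea_mul_sq_le hσ T)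
    have := Edge.diam_le_cell_diam (hmem T hT)
    gcongr
  have hup : volume.real (⋃ T ∈ S, T.carrier) ≤ discArea * (σ / 2 * e.diam) ^ 2 := by
    rw [← volume_real_closedBall a (by positivity)]
    exact measureReal_mono hsub measure_closedBall_lt_top.ne
  have hfin : (S.card : ℝ) * (discArea * (e.diam / σ) ^ 2) ≤
      σ ^ 4 / 4 * (discArea * (e.diam / σ) ^ 2) := by
    refine (hlow.trans (hvol ▸ hup)).trans_eq ?_
    field_simp
    ring
  exact le_of_mul_le_mul_right hfin (by positivity)

/-! ### Piecewise affine fields with prescribed gradient -/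

/-- The affine polynomial `x ↦ ∑ j, a j * (x j - b j)`. -/
def affinePoly (a : Fin 2 → ℝ) (b : Plane) : MvPolynomial (Fin 2) ℝ :=
  ∑ j, MvPolynomial.C (a j) * (MvPolynomial.X j - MvPolynomial.C (b j))

theorem affinePoly_mem (a : Fin 2 → ℝ) (b : Plane) :
    affinePoly a b ∈ MvPolynomial.restrictTotalDegree (Fin 2) ℝ 2 := by
  rw [MvPolynomial.mem_restrictTotalDegree]
  refine MvPolynomial.totalDegree_finsetSum_le fun j _ => ?_
  refine (MvPolynomial.totalDegree_mul _ _).trans ?_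
  have h := MvPolynomial.totalDegree_sub (MvPolynomial.X j) (MvPolynomial.C (σ := Fin 2) (b j))
  simp at h ⊢
  omega

/-- The field that on every triangle `T` is affine with gradient `μ T` and vanishes at the
barycenter of `T`. -/
def affineField (μ : 𝒯.Mh) : 𝒯.Vh := fun T i =>
  ⟨affinePoly (μ T i) T.barycenter, affinePoly_mem _ _⟩

theorem val_affineField (μ : 𝒯.Mh) (T : 𝒯.Cell) (x : Plane) (i : Fin 3) :
    val (affineField μ) T x i = ∑ j, μ T i j * (x - T.barycenter) j := by
  simp [val, affineField, affinePoly]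

theorem pderiv_affinePoly (a : Fin 2 → ℝ) (b : Plane) (j : Fin 2) :
    MvPolynomial.pderiv j (affinePoly a b) = MvPolynomial.C (a j) := by
  fin_cases j <;> simp [affinePoly, Fin.sum_univ_two, MvPolynomial.pderiv_X]

theorem grad_affineField (μ : 𝒯.Mh) : grad (affineField μ) = const μ := by
  ext T x i j
  simp [grad, affineField, const, pderiv_affinePoly]

theorem hess_affineField (μ : 𝒯.Mh) (T : 𝒯.Cell) (x : Plane) (i : Fin 3) (j k : Fin 2) :
    hess (affineField μ) T x i j k = 0 := by
  simp [hess, affineField, pderiv_affinePoly]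

/-- The linearised isometry constraint of a field involves its gradient only. -/
theorem L1_affineField (y : 𝒯.Vh) (μ : 𝒯.Mh) : L1 y (affineField μ) = L2 y μ :=
  upsh_ext fun γ => by rw [L1_spec, L2_spec, grad_affineField]

/-! ### The inverse estimate -/

theorem frob_self_nonneg {n m : ℕ} (A : Matrix (Fin n) (Fin m) ℝ) : 0 ≤ frob A A :=
  Finset.sum_nonneg fun _ _ => Finset.sum_nonneg fun _ _ => mul_self_nonneg _

theorem sum_mulVec_sq_le (A : Matrix (Fin 3) (Fin 2) ℝ) (v : Plane) :
    ∑ i, (∑ j, A i j * v j) ^ 2 ≤ frob A A * ‖v‖ ^ 2 := by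
  rw [frob, Finset.sum_mul, EuclideanSpace.real_norm_sq_eq]
  refine Finset.sum_le_sum fun i _ => ?_
  simpa only [← sq] using Finset.sum_mul_sq_le_sq_mul_sq Finset.univ (A i) v

theorem Edge.side_sq (e : 𝒯.Edge) (T : 𝒯.Cell) : e.side T ^ 2 = 1 := by
  unfold Edge.side
  split_ifs <;> norm_num

/-- Both jumps of `affineField μ` over an edge are signed sums of the vectors `μ T *ᵥ v T`, with
`v T` the unit normal for the gradient and `v T = x - x_T` for the values. -/
theorem sum_sq_signed_sum_le (e : 𝒯.Edge) (μ : 𝒯.Mh) (S : Finset 𝒯.Cell) (v : 𝒯.Cell → Plane)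
    {R : ℝ} (hv : ∀ T ∈ S, ‖v T‖ ≤ R) :
    ∑ i, (∑ T ∈ S, e.side T * ∑ j, μ T i j * v T j) ^ 2 ≤
      S.card * R ^ 2 * ∑ T ∈ S, frob (μ T) (μ T) := by
  calc ∑ i, (∑ T ∈ S, e.side T * ∑ j, μ T i j * v T j) ^ 2
      ≤ ∑ i, (S.card : ℝ) * ∑ T ∈ S, (e.side T * ∑ j, μ T i j * v T j) ^ 2 :=
        Finset.sum_le_sum fun i _ => sq_sum_le_card_mul_sum_sq
    _ = S.card * ∑ T ∈ S, ∑ i, (∑ j, μ T i j * v T j) ^ 2 := by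
        simp only [mul_pow, Edge.side_sq, one_mul]
        rw [← Finset.mul_sum, Finset.sum_comm]
    _ ≤ S.card * ∑ T ∈ S, frob (μ T) (μ T) * R ^ 2 := by
        gcongr with T hT
        refine (sum_mulVec_sq_le _ _).trans ?_
        have := frob_self_nonneg (μ T)
        have := hv T hT
        gcongr
    _ = _ := by rw [← Finset.sum_mul]; ring

theorem Edge.setIntegral_le (e : 𝒯.Edge) {f : Plane → ℝ} {C : ℝ} (hf0 : ∀ x, 0 ≤ f x)
    (hf : ∀ x ∈ e.carrier, f x ≤ C) :
    ∫ x in e.carrier, f x ∂(Measure.hausdorffMeasure 1) ≤ C * e.diam := by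
  have hμ := e.hausdorffMeasure_carrier
  have h := norm_setIntegral_le_of_norm_le_const (μ := Measure.hausdorffMeasure 1)
    (s := e.carrier) (f := f) (C := C) (by rw [hμ]; exact ENNReal.ofReal_lt_top)
    (fun x hx => by rw [Real.norm_of_nonneg (hf0 x)]; exact hf x hx)
  rw [measureReal_def, hμ, ENNReal.toReal_ofReal e.diam_pos.le] at h
  exact (Real.le_norm_self _).trans h

theorem Edge.norm_normal (e : 𝒯.Edge) : ‖e.normal‖ = 1 := e.exists_normal.choose_spec.1

open Classical in
theorem Edge.gradJump_term_le (e : 𝒯.Edge) (μ : 𝒯.Mh) :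
    e.diam⁻¹ * ∫ x in e.carrier, ∑ i, jumpGrad (affineField μ) e x i ^ 2
        ∂(Measure.hausdorffMeasure 1) ≤
      (Finset.univ.filter fun T : 𝒯.Cell => e.1 ⊆ T.1).card *
        ∑ T : 𝒯.Cell with e.1 ⊆ T.1, frob (μ T) (μ T) := by
  have he := e.diam_pos
  rw [inv_mul_le_iff₀ he, mul_comm e.diam]
  refine e.setIntegral_le (fun x => Finset.sum_nonneg fun i _ => sq_nonneg _) fun x _ => ?_
  have h := sum_sq_signed_sum_le e μ (Finset.univ.filter fun T : 𝒯.Cell => e.1 ⊆ T.1)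
    (fun _ => e.normal) (R := 1) fun T _ => e.norm_normal.le
  simpa [jumpGrad, grad_affineField, const] using h

open Classical in
/-- On the edge the field is bounded by `h_T * |μ T|`, as it vanishes at the barycenter; since `h_T`
is of order `h_e`, the weight `h_e⁻³` is compensated. -/
theorem Edge.jump_term_le {σ : ℝ} (h𝒯 : 𝒯.IsShapeRegular σ) (hσ : 0 < σ) (e : 𝒯.Edge)
    (μ : 𝒯.Mh) :
    (e.diam ^ 3)⁻¹ * ∫ x in e.carrier, ∑ i, jump (affineField μ) e x i ^ 2
        ∂(Measure.hausdorffMeasure 1) ≤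
      (Finset.univ.filter fun T : 𝒯.Cell => e.1 ⊆ T.1).card * (σ / 2) ^ 2 *
        ∑ T : 𝒯.Cell with e.1 ⊆ T.1, frob (μ T) (μ T) := by
  have he := e.diam_pos
  rw [inv_mul_le_iff₀ (by positivity)]
  refine (e.setIntegral_le (fun x => Finset.sum_nonneg fun i _ => sq_nonneg _) fun x hx => ?_
    : _ ≤ ((Finset.univ.filter fun T : 𝒯.Cell => e.1 ⊆ T.1).card * (σ / 2 * e.diam) ^ 2 *
        ∑ T : 𝒯.Cell with e.1 ⊆ T.1, frob (μ T) (μ T)) * e.diam).trans_eq (by ring)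
  have h := sum_sq_signed_sum_le e μ (Finset.univ.filter fun T : 𝒯.Cell => e.1 ⊆ T.1)
    (fun T => x - T.barycenter) (R := σ / 2 * e.diam) fun T hT => by
      have heT := (Finset.mem_filter.1 hT).2
      rw [← dist_eq_norm]
      exact (T.dist_le_diam (Edge.carrier_subset heT hx) T.barycenter_mem).trans
        (h𝒯.cell_diam_le hσ heT)
  simpa only [jump, val_affineField] using h

/-- The constant in the bound of `‖w‖²_{H²_h}` by `∑ T, |μ T|²` for `w = affineField μ`: a triangle
has three edges, an edge belongs to at most `σ⁴ / 4` triangles, and the two jump terms contribute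
`1` and `(σ / 2)²`. -/
def jumpConst (σ : ℝ) : ℝ := 3 * (σ ^ 4 / 4 * (1 + (σ / 2) ^ 2))

theorem jumpConst_pos {σ : ℝ} (hσ : 0 < σ) : 0 < jumpConst σ := by
  unfold jumpConst
  positivity

open Classical in
theorem sum_edges_sum_cells_le (f : 𝒯.Cell → ℝ) (hf : ∀ T, 0 ≤ f T) (E : Finset 𝒯.Edge) :
    ∑ e ∈ E, ∑ T : 𝒯.Cell with e.1 ⊆ T.1, f T ≤ 3 * ∑ T, f T := by
  calc ∑ e ∈ E, ∑ T : 𝒯.Cell with e.1 ⊆ T.1, f T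
      ≤ ∑ e : 𝒯.Edge, ∑ T : 𝒯.Cell with e.1 ⊆ T.1, f T :=
        Finset.sum_le_univ_sum_of_nonneg fun e => Finset.sum_nonneg fun T _ => hf T
    _ = ∑ T : 𝒯.Cell, ∑ e : 𝒯.Edge with e.1 ⊆ T.1, f T := by
        simp only [Finset.sum_filter]
        exact Finset.sum_comm
    _ ≤ ∑ T : 𝒯.Cell, 3 * f T := by
        refine Finset.sum_le_sum fun T _ => ?_
        rw [Finset.sum_const, nsmul_eq_mul]
        have h3 : ((Finset.univ.filter fun e : 𝒯.Edge => e.1 ⊆ T.1).card : ℝ) ≤ 3 := by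
          exact_mod_cast Edge.card_cell_edges_le T
        have := hf T
        gcongr
    _ = 3 * ∑ T, f T := (Finset.mul_sum _ _ _).symm

theorem normH2h_affineField_sq_le {σ : ℝ} (h𝒯 : 𝒯.IsShapeRegular σ) (hσ : 0 < σ)
    (ΓD : Set Plane) (μ : 𝒯.Mh) :
    normH2h ΓD (affineField μ) ^ 2 ≤ jumpConst σ * ∑ T, frob (μ T) (μ T) := by
  classical
  have hF : ∀ T, 0 ≤ frob (μ T) (μ T) := fun T => frob_self_nonneg _
  set K : ℝ := σ ^ 4 / 4 with hK
  have hK0 : 0 ≤ K := by positivity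
  unfold normH2h
  rw [Real.sq_sqrt']
  refine max_le ?_ (mul_nonneg (jumpConst_pos hσ).le (Finset.sum_nonneg fun T _ => hF T))
  have hhess : ∑ T : 𝒯.Cell, ∫ x in T.carrier, ∑ i, ∑ j, ∑ k,
      hess (affineField μ) T x i j k ^ 2 = 0 := by
    simp [hess_affineField]
  rw [hhess, zero_add, ← Finset.sum_add_distrib]
  calc _ ≤ ∑ e ∈ 𝒯.activeEdges ΓD, K * (1 + (σ / 2) ^ 2) *
          ∑ T : 𝒯.Cell with e.1 ⊆ T.1, frob (μ T) (μ T) := by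
        refine Finset.sum_le_sum fun e _ => ?_
        refine (add_le_add (e.gradJump_term_le μ) (e.jump_term_le h𝒯 hσ μ)).trans ?_
        have hc := h𝒯.card_cells_le hσ e
        have hs : 0 ≤ ∑ T : 𝒯.Cell with e.1 ⊆ T.1, frob (μ T) (μ T) :=
          Finset.sum_nonneg fun T _ => hF T
        rw [mul_add, mul_one, add_mul]
        gcongr
    _ = K * (1 + (σ / 2) ^ 2) * ∑ e ∈ 𝒯.activeEdges ΓD,
          ∑ T : 𝒯.Cell with e.1 ⊆ T.1, frob (μ T) (μ T) := (Finset.mul_sum _ _ _).symm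
    _ ≤ K * (1 + (σ / 2) ^ 2) * (3 * ∑ T, frob (μ T) (μ T)) := by
        gcongr
        exact sum_edges_sum_cells_le _ hF _
    _ = jumpConst σ * ∑ T, frob (μ T) (μ T) := by
        rw [jumpConst]
        ring

theorem innerL2_const_self (μ : 𝒯.Mh) :
    innerL2 (const μ) (const μ) = ∑ T, volume.real T.carrier * frob (μ T) (μ T) := by
  simp [innerL2, const]

theorem innerL2_const_self_pos {μ : 𝒯.Mh} (hμ : μ ≠ 0) : 0 < innerL2 (const μ) (const μ) := by
  obtain ⟨T, hT⟩ := Function.ne_iff.1 hμ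
  have hF : 0 < frob (μ T) (μ T) := by
    refine (frob_self_nonneg _).lt_of_ne' fun h0 => hT ?_
    rw [frob, Finset.sum_eq_zero_iff_of_nonneg
      (fun i _ => Finset.sum_nonneg fun j _ => mul_self_nonneg (μ T i j))] at h0
    ext i j
    have h1 := h0 i (Finset.mem_univ i)
    rw [Finset.sum_eq_zero_iff_of_nonneg (fun j _ => mul_self_nonneg (μ T i j))] at h1
    exact mul_self_eq_zero.1 (h1 j (Finset.mem_univ j))
  rw [innerL2_const_self]
  exact Finset.sum_pos' (fun T _ => mul_nonneg measureReal_nonneg (frob_self_nonneg _))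
    ⟨T, Finset.mem_univ T, mul_pos T.volume_real_pos hF⟩

theorem discArea_mul_hMin_sq_le_innerL2 {σ : ℝ} (h𝒯 : 𝒯.IsShapeRegular σ) (hσ : 0 < σ)
    (μ : 𝒯.Mh) :
    discArea * (𝒯.hMin / σ) ^ 2 * ∑ T, frob (μ T) (μ T) ≤ innerL2 (const μ) (const μ) := by
  rw [innerL2_const_self, Finset.mul_sum]
  refine Finset.sum_le_sum fun T _ => ?_
  have h0 := 𝒯.hMin_nonneg
  have h1 := T.hMin_le_diam
  have h2 := discArea_pos
  refine mul_le_mul_of_nonneg_right (le_trans ?_ (h𝒯.discArea_mul_sq_le hσ T))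
    (frob_self_nonneg _)
  gcongr

/-- The constant `β'` of the inf-sup condition, chosen so that
`β'² * jumpConst σ * h_min² = discArea * (h_min / σ)²`: the left side comes from
`normH2h_affineField_sq_le`, the right side from `discArea_mul_hMin_sq_le_innerL2`. -/
def infSupConst (σ : ℝ) : ℝ := Real.sqrt (discArea / (σ ^ 2 * jumpConst σ))

theorem infSupConst_pos {σ : ℝ} (hσ : 0 < σ) : 0 < infSupConst σ :=
  Real.sqrt_pos.2 (div_pos discArea_pos (mul_pos (by positivity) (jumpConst_pos hσ)))

/-- The inverse estimate: the jumps cost a factor `1 / h_min`, because `‖w‖²_{H²_h}` is bounded by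
the unweighted sum of the `|μ T|²`, whereas `‖μ‖²` weights them by the areas of the triangles. -/
theorem infSupConst_mul_normH2h_le {σ : ℝ} (h𝒯 : 𝒯.IsShapeRegular σ) (hσ : 0 < σ)
    (ΓD : Set Plane) (μ : 𝒯.Mh) :
    infSupConst σ * 𝒯.hMin * normH2h ΓD (affineField μ) ≤ normL2 (const μ) := by
  refine Real.le_sqrt_of_sq_le ?_
  have hJ := jumpConst_pos hσ
  have hd := discArea_pos
  rw [mul_pow, mul_pow, infSupConst, Real.sq_sqrt (by positivity)]
  refine le_trans (mul_le_mul_of_nonneg_left (normH2h_affineField_sq_le h𝒯 hσ ΓD μ)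
    (by positivity)) (le_trans (le_of_eq ?_) (discArea_mul_hMin_sq_le_innerL2 h𝒯 hσ μ))
  field_simp

theorem affineField_ne_zero {μ : 𝒯.Mh} (hμ : μ ≠ 0) : affineField μ ≠ 0 := by
  intro h
  refine hμ (funext fun T => ?_)
  have h1 := congrFun (congrFun (grad_affineField μ) T) 0
  rw [h] at h1
  change _ = μ T at h1
  rw [← h1]
  ext i j
  simp [grad]

theorem infSupConst_mul_hMin_le_infSupQuotient {σ : ℝ} (h𝒯 : 𝒯.IsShapeRegular σ) (hσ : 0 < σ)
    (ΓD : Set Plane) {μ : 𝒯.Mh} (hμ : μ ≠ 0) :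
    ENNReal.ofReal (infSupConst σ * 𝒯.hMin) ≤ infSupQuotient ΓD μ (affineField μ) := by
  have hpos := innerL2_const_self_pos hμ
  rw [infSupQuotient, grad_affineField]
  -- a denominator equal to zero is harmless here because the numerator is positive
  rw [ENNReal.le_div_iff_mul_le (Or.inr (ENNReal.ofReal_pos.2 hpos).ne')
    (Or.inl ENNReal.ofReal_ne_top),
    ← ENNReal.ofReal_mul (mul_nonneg (infSupConst_pos hσ).le 𝒯.hMin_nonneg)]
  refine ENNReal.ofReal_le_ofReal ?_
  have h := mul_le_mul_of_nonneg_left (infSupConst_mul_normH2h_le h𝒯 hσ ΓD μ)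
    (show 0 ≤ normL2 (const μ) from Real.sqrt_nonneg _)
  have hsq : normL2 (const μ) * normL2 (const μ) = innerL2 (const μ) (const μ) :=
    Real.mul_self_sqrt hpos.le
  rw [hsq] at h
  linarith

end Triangulation

end PlateFEM

end

theorem mainTheorem10 (Ω : Set PlateFEM.Plane) (hΩ_open : IsOpen Ω) (hΩ_conn : IsConnected Ω)
    (hΩ_bdd : Bornology.IsBounded Ω) (hΩ_reg : interior (closure Ω) = Ω)
    (ΓD : Set PlateFEM.Plane)
    (hΓD : ∃ U : Set PlateFEM.Plane, IsOpen U ∧ ΓD = U ∩ frontier Ω)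
    {ι : Type*} (𝒯 : ι → PlateFEM.Triangulation Ω)
    (h_shape : ∃ σ : ℝ, 0 < σ ∧ ∀ h : ι, (𝒯 h).IsShapeRegular σ) :
    ∃ β' : ℝ, 0 < β' ∧ ∀ h : ι, ∀ y ∈ (𝒯 h).admissible,
      ENNReal.ofReal (β' * (𝒯 h).hMin) ≤
        ⨅ μ ∈ {μ : (𝒯 h).Mh | μ ∈ LinearMap.ker (PlateFEM.Triangulation.L2 y) ∧ μ ≠ 0},
          ⨆ w ∈ {w : (𝒯 h).Vh | w ∈ LinearMap.ker (PlateFEM.Triangulation.L1 y) ∧ w ≠ 0},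
            PlateFEM.Triangulation.infSupQuotient ΓD μ w := by
  obtain ⟨σ, hσ, hs⟩ := h_shape
  refine ⟨PlateFEM.Triangulation.infSupConst σ, PlateFEM.Triangulation.infSupConst_pos hσ,
    fun h y _ => le_iInf₂ fun μ hμ => ?_⟩
  refine le_trans
    (PlateFEM.Triangulation.infSupConst_mul_hMin_le_infSupQuotient (hs h) hσ ΓD hμ.2)
    (le_iSup₂_of_le (PlateFEM.Triangulation.affineField μ) ⟨?_, ?_⟩ le_rfl)
  · rw [LinearMap.mem_ker, PlateFEM.Triangulation.L1_affineField]
    exact LinearMap.mem_ker.1 hμ.1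
  · exact PlateFEM.Triangulation.affineField_ne_zero hμ.2
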